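/- Let $\mathcal X\subset\mathbb R^d$, $\mathcal Y\subset\mathbb R$, let $\rho$ be a Borel probability measure on $\mathcal Z=\mathcal X\times\mathcal Y$, and let $H_K$, with norm $\|\cdot\|$, be the reproducing kernel Hilbert space of a continuous, symmetric, positive semidefinite kernel $K:\mathcal X\times\mathcal X\to\mathbb R$ with $\kappa:=\sup_{x\in\mathcal X}\sqrt{K(x,x)}<\infty$; write $K_x=K(x,\cdot)$. Let $\phi:\mathcal Y\times\mathbb R\to[0,\infty)$ be a (measurable) loss that is convex and differentiable in its second argument, with derivative $\phi'$ in that argument satisfying $|\phi'(y,s)-\phi'(y,\tilde s)|\le L|s-\tilde s|^\alpha$ for all $y\in\mathcal Y$, $s,\tilde s\in\mathbb R$, where $\alpha\in(0,1]$ and $L>0$. Let $\mathcal E(f)=\int_{\mathcal Z}\phi(y,f(x))\,d\rho(x,y)$, assume that $\mathcal E$ has a minimizer $f_H$ over $H_K$, and that $\sup_{y\in\mathcal Y}\phi(y,0)<\infty$ and $\sup_{(x,y)\in\mathcal Z}\phi(y,f_H(x))<\infty$. Put $$A=2\,\alpha^{\frac{1-\alpha}{1+\alpha}}L^{\frac{2}{1+\alpha}}(1+\alpha).$$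 Let $(\eta_t)_{t\ge1}$ be positive step sizes with $A\kappa^2\eta_t\le 1$ and $\eta_{t+1}\le\eta_t$ for all $t\ge 1$, and $\sum_{t=1}^\infty\eta_t^2<\infty$. Let $z_t=(x_t,y_t)$, $t\ge1$, be independent random examples with law $\rho$, and let $f_1=0$ and $$f_{t+1}=f_t-\eta_t\,\phi'(y_t,f_t(x_t))K_{x_t},\qquad t\ge1 .$$ Then there is a constant $\widetilde C$, independent of $T$ and $\delta$, such that for every integer $T\ge1$ and every $\delta\in(0,1)$, with probability at least $1-\delta$ both $$\sum_{t=1}^T\eta_t\big[\mathcal E(f_t)-\mathcal E(f_H)\big]\le\widetilde C\log^{3/2}\frac{2T}{\delta} \qquad\text{and}\qquad \mathcal E(\bar f_T^{\eta})-\mathcal E(f_H)\le\frac{\widetilde C\log^{3/2}\frac{2T}{\delta}}{\sum_{t=1}^T\eta_t}$$ hold, where $\bar f_T^{\eta}=\big(\sum_{t=1}^T\eta_t\big)^{-1}\sum_{t=1}^T\eta_tf_t$. -/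

import Mathlib

open MeasureTheory ProbabilityTheory

namespace OnlineLearning

noncomputable section

/-- A Mercer kernel: a continuous, symmetric, positive semidefinite real function on `X × X`. -/
structure IsMercerKernel {X : Type*} [TopologicalSpace X] (K : X → X → ℝ) : Prop where
  continuous : Continuous (fun p : X × X => K p.1 p.2)
  symm : ∀ x x', K x x' = K x' x
  nonneg : ∀ (s : Finset X) (c : X → ℝ), 0 ≤ ∑ x ∈ s, ∑ x' ∈ s, c x * c x' * K x x'

/-- The kernel section `K_x` of a reproducing kernel Hilbert space `H` of real functions on `X`,
i.e. the Riesz representer of the evaluation at `x`: `⟪f, K_x⟫ = f x` for all `f : H`. -/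
def kernelSection {X : Type*} (H : Type*) [NormedAddCommGroup H] [InnerProductSpace ℝ H]
    [CompleteSpace H] [RKHS ℝ H X ℝ] (x : X) : H :=
  RKHS.kerFun H x (1 : ℝ)

/-- `H` is the reproducing kernel Hilbert space with kernel `K`: the section of `H` at `x` is the
function `K x ·`. (A Hilbert space of functions is determined by its reproducing kernel: the
kernel sections always span a dense subspace.) -/
def HasKernel {X : Type*} (H : Type*) [NormedAddCommGroup H] [InnerProductSpace ℝ H]
    [CompleteSpace H] [RKHS ℝ H X ℝ] (K : X → X → ℝ) : Prop :=
  ∀ x x', kernelSection H x x' = K x x'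

/-- `κ = sup_x √(K(x, x))`, meaningful when the set of these values is bounded above. -/
def kernelBound {X : Type*} (K : X → X → ℝ) : ℝ := ⨆ x, √(K x x)

/-- The loss `φ : Y × ℝ → [0, ∞)` is convex and differentiable in its second argument, with
`(α, L)`-Hölder continuous derivative, uniformly in the first argument. -/
structure IsHolderLoss {Y : Type*} (φ : Y → ℝ → ℝ) (α L : ℝ) : Prop where
  nonneg : ∀ y s, 0 ≤ φ y s
  convex : ∀ y, ConvexOn ℝ Set.univ (φ y)
  differentiable : ∀ y, Differentiable ℝ (φ y)
  holder : ∀ y s s', |deriv (φ y) s - deriv (φ y) s'| ≤ L * |s - s'| ^ α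

/-- The constant `A = 2 α^((1-α)/(1+α)) L^(2/(1+α)) (1+α)`. -/
def stepConst (α L : ℝ) : ℝ :=
  2 * α ^ ((1 - α) / (1 + α)) * L ^ (2 / (1 + α)) * (1 + α)

/-- The generalization error `ℰ(f) = ∫ φ(y, f(x)) dρ(x, y)`. -/
def risk {X Y : Type*} [MeasurableSpace X] [MeasurableSpace Y] (ρ : Measure (X × Y))
    (φ : Y → ℝ → ℝ) (f : X → ℝ) : ℝ :=
  ∫ z, φ z.2 (f z.1) ∂ρ

/-- The iterates of online gradient descent along the examples `z 0, z 1, …`, starting from the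
zero function. Examples, step sizes and iterates are numbered from `0`: `ogd H φ η z t`, `η t`,
`z t` are what is written `f_{t+1}`, `η_{t+1}`, `z_{t+1}` when one starts from `1`. -/
def ogd {X Y : Type*} (H : Type*) [NormedAddCommGroup H] [InnerProductSpace ℝ H]
    [CompleteSpace H] [RKHS ℝ H X ℝ] (φ : Y → ℝ → ℝ) (η : ℕ → ℝ) (z : ℕ → X × Y) : ℕ → H
  | 0 => 0
  | t + 1 => ogd H φ η z t
      - (η t * deriv (φ (z t).2) (ogd H φ η z t (z t).1)) • kernelSection H (z t).1

/-- The weighted average of the first `T` terms of `f`, with weights `η`. -/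
def weightedAverage {H : Type*} [AddCommGroup H] [Module ℝ H] (η : ℕ → ℝ) (f : ℕ → H)
    (T : ℕ) : H :=
  (∑ t ∈ Finset.range T, η t)⁻¹ • ∑ t ∈ Finset.range T, η t • f t

end

end OnlineLearning

/-! Write D_t = ‖f_t - f_H‖², Δ_t for the excess risk of f_t, and W_t for the excess loss on the
next example, so that Δ_t is the conditional mean of W_t. A nonnegative loss with Hölder derivative
is self-bounding, φ'² ≤ Aφ + c. With convexity this gives D_{t+1} ≤ D_t - b_t W_t + Eη_t² with η_t ≤
b_t ≤ 2η_t (`norm_sq_step_sub_le`).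

It also bounds the conditional second moment of W_t by κ²D_t(AΔ_t + const). As W_t is bounded below,
that controls the conditional mean of exp(-θW_t). The part of the variance with Δ_t is absorbed by
the drift, because η_t D_t is bounded on every path (`exists_mul_norm_sq_ogd_sub_le`). The part of
order η_t² D_t is absorbed by letting the coefficient of D_t in the exponent decrease with t; the
total decrease is finite as Σ η_t² < ∞.

Hence exp of a multiple of Σ η_t Δ_t has a mean bounded independently of T
(`lintegral_exp_sum_risk_le`). Markov's inequality gives a bound of order 1 + log(1/δ), stronger
than the claim; Jensen's inequality handles the average. -/

namespace OnlineLearning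

/-! ### Self-bounding losses -/

section Loss

variable {Y : Type*} {φ : Y → ℝ → ℝ} {α L : ℝ}

theorem stepConst_pos (hα : 0 < α) (hL : 0 < L) : 0 < stepConst α L := by
  unfold stepConst
  positivity

theorem stepConst_one : stepConst 1 L = 4 * L := by
  norm_num [stepConst]
  ring

/-- Young's inequality with the constant `stepConst α L`. -/
theorem exists_mul_rpow_le (hα : 0 < α) (hα1 : α ≤ 1) (hL : 0 < L) :
    ∃ c : ℝ, 0 ≤ c ∧ ∀ g : ℝ, 0 ≤ g →
      L * (2 * g / stepConst α L) ^ (1 + α) ≤ g ^ 2 / stepConst α L + c := by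
  have hA := stepConst_pos hα hL
  rcases hα1.eq_or_lt with rfl | hα1
  · refine ⟨0, le_rfl, fun g hg => le_of_eq ?_⟩
    rw [stepConst_one, show (1 : ℝ) + 1 = (2 : ℕ) by norm_num, Real.rpow_natCast]
    field_simp
    ring
  · set A := stepConst α L
    set a := L * (2 / A) ^ (1 + α)
    have ha : 0 < a := by positivity
    have hα' : 0 < 1 - α := by linarith
    -- Since 1 + α < 2, the quadratic dominates from this threshold on; below it the left side is at
    -- most its value at M, which serves as c.
    set M := (a * A) ^ (1 / (1 - α))
    have hM : 0 < M := by positivity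
    refine ⟨a * M ^ (1 + α), by positivity, fun g hg => ?_⟩
    have h1 : L * (2 * g / A) ^ (1 + α) = a * g ^ (1 + α) := by
      rw [mul_div_right_comm, Real.mul_rpow (by positivity) hg]
      ring
    rw [h1]
    rcases le_total g M with h | h
    · have : a * g ^ (1 + α) ≤ a * M ^ (1 + α) := by gcongr
      have : 0 ≤ g ^ 2 / A := by positivity
      linarith
    · have hg0 : 0 < g := hM.trans_le h
      have h2 : a * A ≤ g ^ (1 - α) := by
        calc a * A = M ^ (1 - α) := by
              rw [← Real.rpow_mul (by positivity), one_div_mul_cancel hα'.ne', Real.rpow_one]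
          _ ≤ g ^ (1 - α) := by gcongr
      have h3 : g ^ 2 = g ^ (1 - α) * g ^ (1 + α) := by
        rw [← Real.rpow_add hg0, ← Real.rpow_natCast]
        norm_num
      have h4 : a * g ^ (1 + α) ≤ g ^ 2 / A := by
        rw [le_div_iff₀ hA, h3]
        calc a * g ^ (1 + α) * A = a * A * g ^ (1 + α) := by ring
          _ ≤ _ := by gcongr
      have : 0 ≤ a * M ^ (1 + α) := by positivity
      linarith

/-- The mean value theorem gives the constant L; integrating the derivative would give L/(1 + α), a
gain that is not needed. -/
theorem IsHolderLoss.apply_add_le (hφ : IsHolderLoss φ α L) (hα : 0 < α) (hL : 0 < L)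
    (y : Y) (s h : ℝ) :
    φ y (s + h) ≤ φ y s + deriv (φ y) s * h + L * |h| ^ (1 + α) := by
  rcases eq_or_ne h 0 with rfl | hh
  · simp [Real.zero_rpow (by linarith : 1 + α ≠ 0)]
  have key : ∃ ξ, |ξ - s| ≤ |h| ∧ φ y (s + h) - φ y s = deriv (φ y) ξ * h := by
    rcases hh.lt_or_gt with h0 | h0
    · obtain ⟨ξ, hξ, e⟩ := exists_deriv_eq_slope (φ y) (by linarith : s + h < s)
        (hφ.differentiable y).continuous.continuousOn (hφ.differentiable y).differentiableOn
      refine ⟨ξ, ?_, ?_⟩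
      · rw [abs_of_neg h0, abs_le]
        constructor <;> linarith [hξ.1, hξ.2]
      · rw [eq_div_iff (by linarith)] at e
        linarith
    · obtain ⟨ξ, hξ, e⟩ := exists_deriv_eq_slope (φ y) (by linarith : s < s + h)
        (hφ.differentiable y).continuous.continuousOn (hφ.differentiable y).differentiableOn
      refine ⟨ξ, ?_, ?_⟩
      · rw [abs_of_pos h0, abs_le]
        constructor <;> linarith [hξ.1, hξ.2]
      · rw [eq_div_iff (by linarith)] at e
        linarith
  obtain ⟨ξ, hξ, e⟩ := key
  have h1 : (deriv (φ y) ξ - deriv (φ y) s) * h ≤ L * |h| ^ (1 + α) := by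
    calc (deriv (φ y) ξ - deriv (φ y) s) * h
        ≤ |deriv (φ y) ξ - deriv (φ y) s| * |h| := by rw [← abs_mul]; exact le_abs_self _
      _ ≤ (L * |ξ - s| ^ α) * |h| := by gcongr; exact hφ.holder y ξ s
      _ ≤ (L * |h| ^ α) * |h| := by gcongr
      _ = L * |h| ^ (1 + α) := by
          rw [Real.rpow_add (abs_pos.2 hh), Real.rpow_one]; ring
  linarith [sub_mul (deriv (φ y) ξ) (deriv (φ y) s) h]

/-- The self-bounding property of a nonnegative function with Hölder continuous derivative. -/
theorem IsHolderLoss.exists_sq_deriv_le (hφ : IsHolderLoss φ α L) (hα : 0 < α) (hα1 : α ≤ 1)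
    (hL : 0 < L) :
    ∃ c : ℝ, 0 ≤ c ∧ ∀ y s, deriv (φ y) s ^ 2 ≤ stepConst α L * φ y s + c := by
  obtain ⟨c, hc, h⟩ := exists_mul_rpow_le hα hα1 hL
  have hA := stepConst_pos hα hL
  refine ⟨stepConst α L * c, by positivity, fun y s => ?_⟩
  set A := stepConst α L
  set g := deriv (φ y) s
  -- This displacement makes the linear term -2g²/A, while the Hölder remainder is at most g²/A + c.
  -- The loss stays nonnegative at the new point, so g²/A ≤ φ y s + c.
  have h1 := hφ.apply_add_le hα hL y s (-(2 * g / A))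
  have h2 := hφ.nonneg y (s + -(2 * g / A))
  have h3 : |-(2 * g / A)| = 2 * |g| / A := by
    rw [abs_neg, abs_div, abs_mul, abs_of_pos hA, abs_of_pos (zero_lt_two' ℝ)]
  have h4 := h |g| (abs_nonneg g)
  rw [h3] at h1
  rw [sq_abs] at h4
  have h5 : g * -(2 * g / A) = -2 * (g ^ 2 / A) := by ring
  have h6 : g ^ 2 / A ≤ φ y s + c := by linarith
  rw [div_le_iff₀ hA] at h6
  linarith

theorem IsHolderLoss.add_deriv_mul_le (hφ : IsHolderLoss φ α L) (y : Y) (s s' : ℝ) :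
    φ y s + deriv (φ y) s * (s' - s) ≤ φ y s' := by
  rcases lt_trichotomy s s' with h | rfl | h
  · have := (hφ.convex y).deriv_le_slope (Set.mem_univ s) (Set.mem_univ s') h
      (hφ.differentiable y s)
    rw [slope_def_field, le_div_iff₀ (by linarith)] at this
    linarith
  · simp
  · have := (hφ.convex y).slope_le_deriv (Set.mem_univ s') (Set.mem_univ s) h
      (hφ.differentiable y s)
    rw [slope_def_field, div_le_iff₀ (by linarith)] at this
    linarith

/-- The tangent at the point of larger loss bounds the difference, and self-bounding replaces its
squared slope by the loss. This makes the second moment of the excess loss linear in the excess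
risk. -/
theorem IsHolderLoss.sq_sub_le (hφ : IsHolderLoss φ α L) {A c : ℝ} (hA : 0 ≤ A) (hc : 0 ≤ c)
    (h : ∀ y s, deriv (φ y) s ^ 2 ≤ A * φ y s + c) (y : Y) (s s' : ℝ) :
    (φ y s - φ y s') ^ 2 ≤ (A * φ y s + A * φ y s' + 2 * c) * (s - s') ^ 2 := by
  have h1 := hφ.add_deriv_mul_le y s s'
  have h2 := hφ.add_deriv_mul_le y s' s
  have h3 := h y s
  have h4 := h y s'
  have h5 := mul_nonneg hA (hφ.nonneg y s)
  have h6 := mul_nonneg hA (hφ.nonneg y s')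
  have h7 := sq_nonneg (s - s')
  rcases le_total 0 (φ y s - φ y s') with h0 | h0
  · calc (φ y s - φ y s') ^ 2 ≤ (deriv (φ y) s * (s - s')) ^ 2 := by
          apply pow_le_pow_left₀ h0; linarith
      _ = deriv (φ y) s ^ 2 * (s - s') ^ 2 := by ring
      _ ≤ _ := by gcongr; linarith
  · calc (φ y s - φ y s') ^ 2 = (φ y s' - φ y s) ^ 2 := by ring
      _ ≤ (deriv (φ y) s' * (s' - s)) ^ 2 := by
          apply pow_le_pow_left₀ (by linarith); linarith
      _ = deriv (φ y) s' ^ 2 * (s - s') ^ 2 := by ring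
      _ ≤ _ := by gcongr; linarith

theorem IsHolderLoss.measurable_deriv [MeasurableSpace Y] (hφ : IsHolderLoss φ α L)
    (hm : Measurable fun p : Y × ℝ => φ p.1 p.2) :
    Measurable fun p : Y × ℝ => deriv (φ p.1) p.2 := by
  refine measurable_of_tendsto_metrizable
    (f := fun (n : ℕ) (p : Y × ℝ) =>
      (((n : ℝ) + 1)⁻¹)⁻¹ • (φ p.1 (p.2 + ((n : ℝ) + 1)⁻¹) - φ p.1 p.2)) (fun n => ?_) ?_
  · have : Measurable fun p : Y × ℝ => φ p.1 (p.2 + ((n : ℝ) + 1)⁻¹) :=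
      hm.comp (measurable_fst.prodMk (measurable_snd.add_const _))
    exact (this.sub hm).const_mul _
  · rw [tendsto_pi_nhds]
    intro p
    have h := (hφ.differentiable p.1 p.2).hasDerivAt.tendsto_slope_zero
    refine h.comp (tendsto_nhdsWithin_iff.2 ⟨?_, .of_forall fun n => ?_⟩)
    · simpa using tendsto_one_div_add_atTop_nhds_zero_nat (𝕜 := ℝ)
    · simp only [Set.mem_compl_iff, Set.mem_singleton_iff]
      positivity

end Loss

/-! ### Kernel sections -/

section Kernel

variable {X : Type*} {H : Type*} [NormedAddCommGroup H] [InnerProductSpace ℝ H]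
  [CompleteSpace H] [RKHS ℝ H X ℝ] {K : X → X → ℝ}

theorem inner_kernelSection (f : H) (x : X) : inner ℝ f (kernelSection H x) = f x := by
  simp [kernelSection]

theorem HasKernel.norm_sq_kernelSection (hH : HasKernel H K) (x : X) :
    ‖kernelSection H x‖ ^ 2 = K x x := by
  rw [← real_inner_self_eq_norm_sq, inner_kernelSection, hH]

theorem HasKernel.norm_sq_kernelSection_le (hH : HasKernel H K)
    (hκ : BddAbove (Set.range fun x : X => √(K x x))) (x : X) :
    ‖kernelSection H x‖ ^ 2 ≤ kernelBound K ^ 2 := by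
  have h0 : 0 ≤ K x x := by rw [← hH.norm_sq_kernelSection]; positivity
  rw [hH.norm_sq_kernelSection, ← Real.sq_sqrt h0]
  exact pow_le_pow_left₀ (Real.sqrt_nonneg _) (le_ciSup hκ x) 2

theorem HasKernel.sq_apply_le (hH : HasKernel H K)
    (hκ : BddAbove (Set.range fun x : X => √(K x x))) (f : H) (x : X) :
    f x ^ 2 ≤ kernelBound K ^ 2 * ‖f‖ ^ 2 := by
  rw [← inner_kernelSection f x]
  calc (inner ℝ f (kernelSection H x)) ^ 2
      ≤ (‖f‖ * ‖kernelSection H x‖) ^ 2 :=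
        sq_le_sq' (neg_le_of_abs_le (abs_real_inner_le_norm _ _)) (real_inner_le_norm _ _)
    _ = ‖kernelSection H x‖ ^ 2 * ‖f‖ ^ 2 := by ring
    _ ≤ _ := mul_le_mul_of_nonneg_right (hH.norm_sq_kernelSection_le hκ x) (sq_nonneg _)

theorem HasKernel.continuous_kernelSection [TopologicalSpace X] (hH : HasKernel H K)
    (hK : Continuous fun p : X × X => K p.1 p.2) : Continuous (kernelSection H : X → H) := by
  rw [continuous_iff_continuousAt]
  intro x
  have h : ∀ x', ‖kernelSection H x' - kernelSection H x‖ =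
      √(K x' x' - 2 * K x' x + K x x) := fun x' => by
    rw [← Real.sqrt_sq (norm_nonneg (kernelSection H x' - kernelSection H x)),
      norm_sub_sq_real, hH.norm_sq_kernelSection, hH.norm_sq_kernelSection,
      inner_kernelSection, hH]
  rw [ContinuousAt, tendsto_iff_norm_sub_tendsto_zero]
  simp_rw [h]
  have h1 : Continuous fun x' => K x' x' := hK.comp (continuous_id.prodMk continuous_id)
  have h2 : Continuous fun x' => K x' x := hK.comp (continuous_id.prodMk continuous_const)
  have h3 : Continuous fun x' => √(K x' x' - 2 * K x' x + K x x) := by fun_prop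
  convert h3.tendsto x using 2
  rw [eq_comm, Real.sqrt_eq_zero_of_nonpos]
  linarith

end Kernel

/-- Below -1 the right side already exceeds 1, so no lower bound on x is needed. -/
theorem exp_le_one_add_add_sq {x : ℝ} (hx : x ≤ 1) : Real.exp x ≤ 1 + x + x ^ 2 := by
  rcases le_total (-1) x with h | h
  · have := (abs_le.1 (Real.abs_exp_sub_one_sub_id_le (abs_le.2 ⟨h, hx⟩))).2
    linarith
  · have : Real.exp x ≤ 1 := Real.exp_le_one_iff.2 (by linarith)
    nlinarith

/-- A one-sided bound of the moment generating function: no upper bound of `W` enters. -/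
theorem lintegral_exp_neg_mul_le {Z : Type*} [MeasurableSpace Z] {ρ : Measure Z}
    [IsProbabilityMeasure ρ] {W : Z → ℝ} {θ B : ℝ} (hW : Integrable W ρ)
    (hW2 : Integrable (fun z => W z ^ 2) ρ) (hB : ∀ z, -B ≤ W z) (hθ : 0 ≤ θ) (hθB : θ * B ≤ 1) :
    ∫⁻ z, ENNReal.ofReal (Real.exp (-(θ * W z))) ∂ρ ≤
      ENNReal.ofReal (Real.exp (-(θ * ∫ z, W z ∂ρ) + θ ^ 2 * ∫ z, W z ^ 2 ∂ρ)) := by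
  have hp : ∀ z, Real.exp (-(θ * W z)) ≤ 1 - θ * W z + θ ^ 2 * W z ^ 2 := fun z => by
    have : -(θ * W z) ≤ 1 := by nlinarith [mul_le_mul_of_nonneg_left (hB z) hθ]
    have := exp_le_one_add_add_sq this
    linarith
  have hi1 : Integrable (fun z => 1 - θ * W z) ρ := (integrable_const 1).sub (hW.const_mul θ)
  have hi : Integrable (fun z => 1 - θ * W z + θ ^ 2 * W z ^ 2) ρ := hi1.add (hW2.const_mul _)
  calc ∫⁻ z, ENNReal.ofReal (Real.exp (-(θ * W z))) ∂ρ
      ≤ ∫⁻ z, ENNReal.ofReal (1 - θ * W z + θ ^ 2 * W z ^ 2) ∂ρ :=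
        lintegral_mono fun z => ENNReal.ofReal_le_ofReal (hp z)
    _ = ENNReal.ofReal (∫ z, (1 - θ * W z + θ ^ 2 * W z ^ 2) ∂ρ) :=
        (ofReal_integral_eq_lintegral_ofReal hi
          (.of_forall fun z => (Real.exp_pos _).le.trans (hp z))).symm
    _ ≤ _ := by
        apply ENNReal.ofReal_le_ofReal
        rw [integral_add hi1 (hW2.const_mul _), integral_sub (integrable_const 1) (hW.const_mul θ),
          integral_const_mul, integral_const_mul, integral_const]
        simp only [probReal_univ, smul_eq_mul, mul_one]
        have := Real.add_one_le_exp (-(θ * ∫ z, W z ∂ρ) + θ ^ 2 * ∫ z, W z ^ 2 ∂ρ)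
        linarith

/-! ### One gradient step -/

section Step

variable {X Y : Type*} {H : Type*} [NormedAddCommGroup H] [InnerProductSpace ℝ H]
  [CompleteSpace H] [RKHS ℝ H X ℝ] {K : X → X → ℝ} {φ : Y → ℝ → ℝ} {α L : ℝ}

/-- Self-bounding controls the slope at 0, and f is bounded on X. This makes the loss of every f in
H integrable, so that `risk` is never the default value 0 of the integral. -/
theorem IsHolderLoss.exists_apply_le (hφ : IsHolderLoss φ α L) (hα : 0 < α) (hα1 : α ≤ 1)
    (hL : 0 < L) (hφ0 : BddAbove (Set.range fun y : Y => φ y 0)) (hH : HasKernel H K)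
    (hκ : BddAbove (Set.range fun x : X => √(K x x))) (f : H) :
    ∃ M : ℝ, ∀ y x, φ y (f x) ≤ M := by
  obtain ⟨c, hc, hd⟩ := hφ.exists_sq_deriv_le hα hα1 hL
  obtain ⟨B, hB⟩ := hφ0
  have hA := stepConst_pos hα hL
  set A := stepConst α L
  set R := √(kernelBound K ^ 2 * ‖f‖ ^ 2)
  refine ⟨B + (A * B + c + 1) * R + L * R ^ (1 + α), fun y x => ?_⟩
  have h0 : φ y 0 ≤ B := hB ⟨y, rfl⟩
  have hR : |f x| ≤ R := Real.abs_le_sqrt (hH.sq_apply_le hκ f x)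
  have h1 := hφ.apply_add_le hα hL y 0 (f x)
  rw [zero_add] at h1
  have h2 : |deriv (φ y) 0| ≤ A * B + c + 1 := by
    have h3 := hd y 0
    have h4 : A * φ y 0 ≤ A * B := by gcongr
    rw [← sq_abs] at h3
    nlinarith [sq_nonneg (|deriv (φ y) 0| - 1), abs_nonneg (deriv (φ y) 0)]
  have h3 : deriv (φ y) 0 * f x ≤ (A * B + c + 1) * R := by
    refine (le_abs_self _).trans ?_
    rw [abs_mul]
    have := (abs_nonneg _).trans h2
    gcongr
  have h4 : L * |f x| ^ (1 + α) ≤ L * R ^ (1 + α) := by gcongr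
  linarith

theorem HasKernel.measurable_apply [TopologicalSpace X] [MeasurableSpace X]
    [OpensMeasurableSpace X] (hH : HasKernel H K)
    (hK : Continuous fun p : X × X => K p.1 p.2) (f : H) : Measurable f := by
  have : Continuous f := by
    have h : Continuous fun x => inner ℝ f (kernelSection H x) :=
      continuous_const.inner (hH.continuous_kernelSection hK)
    simpa only [inner_kernelSection] using h
  exact this.measurable

theorem HasKernel.integrable_loss [TopologicalSpace X] [MeasurableSpace X]
    [OpensMeasurableSpace X] [MeasurableSpace Y] (hH : HasKernel H K)
    (hK : Continuous fun p : X × X => K p.1 p.2)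
    (hκ : BddAbove (Set.range fun x : X => √(K x x)))
    (hm : Measurable fun p : Y × ℝ => φ p.1 p.2)
    (hφ : IsHolderLoss φ α L) (hα : 0 < α) (hα1 : α ≤ 1)
    (hL : 0 < L) (hφ0 : BddAbove (Set.range fun y : Y => φ y 0))
    (ρ : Measure (X × Y)) [IsFiniteMeasure ρ] (f : H) :
    Integrable (fun z : X × Y => φ z.2 (f z.1)) ρ := by
  obtain ⟨M, hM⟩ := hφ.exists_apply_le hα hα1 hL hφ0 hH hκ f
  refine Integrable.of_bound (C := M) (Measurable.aestronglyMeasurable ?_)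
    (.of_forall fun z => ?_)
  · exact hm.comp (measurable_snd.prodMk ((hH.measurable_apply hK f).comp measurable_fst))
  · rw [Real.norm_of_nonneg (hφ.nonneg _ _)]
    exact hM _ _

/-- Expand the square: convexity bounds the cross term, self-bounding the squared gradient. The loss
in the latter is charged to the decrease, whence the factor 2η - η²Aκ², which is at least η under
the step size condition. -/
theorem IsHolderLoss.norm_sq_step_sub_le (hφ : IsHolderLoss φ α L) (hH : HasKernel H K)
    (hκ : BddAbove (Set.range fun x : X => √(K x x))) {A c B η : ℝ} (hA : 0 ≤ A)
    (hd : ∀ y s, deriv (φ y) s ^ 2 ≤ A * φ y s + c) (hη : 0 ≤ η)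
    (f g : H) (x : X) (y : Y) (hB : φ y (g x) ≤ B) :
    ‖f - (η * deriv (φ y) (f x)) • kernelSection H x - g‖ ^ 2 ≤ ‖f - g‖ ^ 2
      - (2 * η - η ^ 2 * (A * kernelBound K ^ 2)) * (φ y (f x) - φ y (g x))
      + η ^ 2 * (kernelBound K ^ 2 * (A * B + c)) := by
  set k := kernelSection H x
  set κ := kernelBound K
  set d := deriv (φ y) (f x)
  have h1 : f - (η * d) • k - g = (f - g) - (η * d) • k := by abel
  have h2 : inner ℝ (f - g) k = f x - g x := by
    rw [inner_sub_left, inner_kernelSection, inner_kernelSection]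
  have h3 : ‖f - (η * d) • k - g‖ ^ 2 =
      ‖f - g‖ ^ 2 - 2 * (η * (d * (f x - g x))) + η ^ 2 * (d ^ 2 * ‖k‖ ^ 2) := by
    rw [h1, norm_sub_sq_real, inner_smul_right, h2, norm_smul, mul_pow, Real.norm_eq_abs, sq_abs]
    ring
  have h4 : φ y (f x) - φ y (g x) ≤ d * (f x - g x) := by
    linarith [hφ.add_deriv_mul_le y (f x) (g x)]
  have h5 : d ^ 2 * ‖k‖ ^ 2 ≤
      κ ^ 2 * (A * (φ y (f x) - φ y (g x)) + (A * B + c)) := by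
    have h6 : d ^ 2 ≤ A * (φ y (f x) - φ y (g x)) + (A * B + c) := by
      have := hd y (f x)
      have : A * φ y (g x) ≤ A * B := by gcongr
      linarith
    calc d ^ 2 * ‖k‖ ^ 2 ≤ (A * (φ y (f x) - φ y (g x)) + (A * B + c)) * κ ^ 2 :=
          mul_le_mul h6 (hH.norm_sq_kernelSection_le hκ x) (sq_nonneg _)
            ((sq_nonneg _).trans h6)
      _ = _ := by ring
  have h7 := mul_le_mul_of_nonneg_left h4 hη
  have h8 := mul_le_mul_of_nonneg_left h5 (sq_nonneg η)
  rw [h3]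
  linarith

/-- The conditional expectation of the exponential of the squared distance to `g` after one step
of online gradient descent from `f`. -/
theorem lintegral_exp_norm_sq_step_le [TopologicalSpace X] [MeasurableSpace X]
    [OpensMeasurableSpace X] [MeasurableSpace Y] (hH : HasKernel H K)
    (hK : Continuous fun p : X × X => K p.1 p.2)
    (hκ : BddAbove (Set.range fun x : X => √(K x x)))
    (hm : Measurable fun p : Y × ℝ => φ p.1 p.2)
    (hφ : IsHolderLoss φ α L) (hα : 0 < α) (hα1 : α ≤ 1)
    (hL : 0 < L) (hφ0 : BddAbove (Set.range fun y : Y => φ y 0))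
    (ρ : Measure (X × Y)) [IsProbabilityMeasure ρ] {A c B Q η l l' : ℝ} (hA : 0 ≤ A) (hc : 0 ≤ c)
    (hd : ∀ y s, deriv (φ y) s ^ 2 ≤ A * φ y s + c) (hη : 0 < η)
    (hη_le : η * (A * kernelBound K ^ 2) ≤ 1) (f g : H)
    (hfg : risk ρ φ g ≤ risk ρ φ f) (hQ : η * ‖f - g‖ ^ 2 ≤ Q)
    (hB : ∀ y x, φ y (g x) ≤ B)
    (hl : 0 ≤ l) (hl' : l' ≤ l) (hl2 : l / 2 ≤ l') (hlB : 2 * l * η * B ≤ 1)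
    (hlQ : 16 * l * (Q * (A * kernelBound K ^ 2)) ≤ 1) :
    ∫⁻ z, ENNReal.ofReal (Real.exp
        (l' * ‖f - (η * deriv (φ z.2) (f z.1)) • kernelSection H z.1 - g‖ ^ 2)) ∂ρ ≤
      ENNReal.ofReal (Real.exp ((l' + 8 * (l ^ 2 * (kernelBound K ^ 2 * (A * B + c)) * η ^ 2))
          * ‖f - g‖ ^ 2 - l / 4 * (η * (risk ρ φ f - risk ρ φ g))
          + l * (kernelBound K ^ 2 * (A * B + c)) * η ^ 2)) := by
  set κ := kernelBound K
  set D := ‖f - g‖ ^ 2 with hD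
  have hD0 : 0 ≤ D := sq_nonneg _
  set b := 2 * η - η ^ 2 * (A * κ ^ 2) with hb
  have hb1 : η ≤ b := by nlinarith
  have hb2 : b ≤ 2 * η := by
    have : 0 ≤ η ^ 2 * (A * κ ^ 2) := by positivity
    linarith
  set W : X × Y → ℝ := fun z => φ z.2 (f z.1) - φ z.2 (g z.1) with hWdef
  have hif := hH.integrable_loss hK hκ hm hφ hα hα1 hL hφ0 ρ f
  have hig := hH.integrable_loss hK hκ hm hφ hα hα1 hL hφ0 ρ g
  have hW : Integrable W ρ := hif.sub hig
  have hΔ : ∫ z, W z ∂ρ = risk ρ φ f - risk ρ φ g := integral_sub hif hig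
  set Δ := risk ρ φ f - risk ρ φ g
  have hΔ0 : 0 ≤ Δ := sub_nonneg.2 hfg
  have hB0 : 0 ≤ B := by
    obtain ⟨z⟩ : Nonempty (X × Y) := ρ.nonempty_of_neZero
    exact (hφ.nonneg _ _).trans (hB z.2 z.1)
  have hWB : ∀ z, -B ≤ W z := fun z => by
    have := hφ.nonneg z.2 (f z.1)
    have := hB z.2 z.1
    simp only [hWdef]
    linarith
  have hW2p : ∀ z, W z ^ 2 ≤ κ ^ 2 * D * (A * W z + 2 * (A * B + c)) := fun z => by
    have h1 := hφ.sq_sub_le hA hc hd z.2 (f z.1) (g z.1)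
    have h2 : (f z.1 - g z.1) ^ 2 ≤ κ ^ 2 * D := by
      have := hH.sq_apply_le hκ (f - g) z.1
      rwa [RKHS.coe_sub, Pi.sub_apply] at this
    have h3 : A * φ z.2 (g z.1) ≤ A * B := by gcongr; exact hB _ _
    have h4 := mul_nonneg hA (hφ.nonneg z.2 (f z.1))
    have h5 := mul_nonneg hA (hφ.nonneg z.2 (g z.1))
    calc W z ^ 2 ≤ _ := h1
      _ ≤ (A * W z + 2 * (A * B + c)) * (κ ^ 2 * D) := by
        have h6 : A * φ z.2 (f z.1) + A * φ z.2 (g z.1) + 2 * c ≤ A * W z + 2 * (A * B + c) := by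
          simp only [hWdef]
          linarith
        exact mul_le_mul h6 h2 (sq_nonneg _) (le_trans (by positivity) h6)
      _ = _ := by ring
  have hi2 : Integrable (fun z => κ ^ 2 * D * (A * W z + 2 * (A * B + c))) ρ :=
    ((hW.const_mul A).add (integrable_const _)).const_mul _
  have hW2 : Integrable (fun z => W z ^ 2) ρ :=
    hi2.mono' (hW.aestronglyMeasurable.pow 2) (.of_forall fun z => by
      rw [Real.norm_of_nonneg (sq_nonneg _)]
      exact hW2p z)
  have hV : ∫ z, W z ^ 2 ∂ρ ≤ κ ^ 2 * D * (A * Δ + 2 * (A * B + c)) := by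
    refine (integral_mono hW2 hi2 hW2p).trans (le_of_eq ?_)
    rw [integral_const_mul, integral_add (hW.const_mul A) (integrable_const _),
      integral_const_mul, hΔ]
    simp
  have hl0 : 0 ≤ l' := by linarith
  set E := κ ^ 2 * (A * B + c)
  have hE : 0 ≤ E := by positivity
  have hθ : 0 ≤ l' * b := mul_nonneg hl0 (hη.le.trans hb1)
  have hθ2 : l' * b ≤ 2 * l * η := by
    calc l' * b ≤ l * (2 * η) := mul_le_mul hl' hb2 (hη.le.trans hb1) hl
      _ = _ := by ring
  have hθ1 : l / 2 * η ≤ l' * b := mul_le_mul hl2 hb1 hη.le hl0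
  have hθB : l' * b * B ≤ 1 := (mul_le_mul_of_nonneg_right hθ2 hB0).trans hlB
  have hmgf := lintegral_exp_neg_mul_le hW hW2 hWB hθ hθB
  calc ∫⁻ z, ENNReal.ofReal (Real.exp
        (l' * ‖f - (η * deriv (φ z.2) (f z.1)) • kernelSection H z.1 - g‖ ^ 2)) ∂ρ
      ≤ ∫⁻ z, ENNReal.ofReal (Real.exp (l' * D + l * E * η ^ 2)) *
          ENNReal.ofReal (Real.exp (-(l' * b * W z))) ∂ρ := by
        refine lintegral_mono fun z => ?_
        rw [← ENNReal.ofReal_mul (Real.exp_pos _).le, ← Real.exp_add]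
        refine ENNReal.ofReal_le_ofReal (Real.exp_le_exp.2 ?_)
        have h1 := hφ.norm_sq_step_sub_le hH hκ hA hd hη.le f g z.1 z.2 (hB z.2 z.1)
        have h2 := mul_le_mul_of_nonneg_left h1 hl0
        have h3 : l' * (η ^ 2 * E) ≤ l * (η ^ 2 * E) := by gcongr
        refine h2.trans ?_
        linear_combination h3
    _ = ENNReal.ofReal (Real.exp (l' * D + l * E * η ^ 2)) *
          ∫⁻ z, ENNReal.ofReal (Real.exp (-(l' * b * W z))) ∂ρ :=
        lintegral_const_mul' _ _ ENNReal.ofReal_ne_top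
    _ ≤ ENNReal.ofReal (Real.exp (l' * D + l * E * η ^ 2)) *
          ENNReal.ofReal (Real.exp (-(l' * b * ∫ z, W z ∂ρ) + (l' * b) ^ 2 * ∫ z, W z ^ 2 ∂ρ)) := by
        gcongr
    _ ≤ _ := by
        rw [← ENNReal.ofReal_mul (Real.exp_pos _).le, ← Real.exp_add]
        refine ENNReal.ofReal_le_ofReal (Real.exp_le_exp.2 ?_)
        rw [hΔ]
        -- The variance term with Δ costs at most lηΔ/4 because ηD ≤ Q, out of a drift of at least
        -- lηΔ/2. The rest, 8l²Eη²D, stays as an increase of the coefficient of D.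
        have h1 : (l' * b) ^ 2 * ∫ z, W z ^ 2 ∂ρ ≤
            (2 * l * η) ^ 2 * (κ ^ 2 * D * (A * Δ + 2 * (A * B + c))) := by
          gcongr
        have h2 : l / 2 * η * Δ ≤ l' * b * Δ := by gcongr
        have h3 : (16 * l * (Q * (A * κ ^ 2))) * (l * η * Δ) ≤ 1 * (l * η * Δ) := by gcongr
        have h4 : 16 * l * (η * D * (A * κ ^ 2)) * (l * η * Δ) ≤
            16 * l * (Q * (A * κ ^ 2)) * (l * η * Δ) := by gcongr
        linear_combination h1 + h2 + h3 / 4 + h4 / 4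

end Step

/-- Integrating a function of the past of an i.i.d. sequence and of its next term. -/
theorem lintegral_past_next {Z Ω : Type*} [MeasurableSpace Z] [MeasurableSpace Ω] {μ : Measure Ω}
    [IsProbabilityMeasure μ] {ρ : Measure Z} [IsProbabilityMeasure ρ] {z : ℕ → Ω → Z}
    (hz : ∀ t, Measurable (z t)) (hind : iIndepFun z μ) {t : ℕ} (hρ : μ.map (z t) = ρ)
    {Φ : (ℕ → Z) × Z → ENNReal} (hΦ : Measurable Φ)
    (hpast : ∀ w w' : ℕ → Z, (∀ s < t, w s = w' s) → ∀ a, Φ (w, a) = Φ (w', a)) :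
    ∫⁻ ω, Φ (fun i => z i ω, z t ω) ∂μ = ∫⁻ ω, ∫⁻ a, Φ (fun i => z i ω, a) ∂ρ ∂μ := by
  obtain ⟨z0⟩ : Nonempty Z := ρ.nonempty_of_neZero
  -- Padding by an arbitrary point is harmless, as Φ only sees the first t coordinates.
  let e : (Finset.range t → Z) → ℕ → Z := fun u i =>
    if h : i ∈ Finset.range t then u ⟨i, h⟩ else z0
  have he : Measurable e := by
    refine measurable_pi_lambda _ fun i => ?_
    by_cases h : i ∈ Finset.range t
    · simpa only [e, h, dite_true] using measurable_pi_apply _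
    · simpa only [e, h, dite_false] using measurable_const
  let U : Ω → Finset.range t → Z := fun ω i => z i ω
  have hU : Measurable U := measurable_pi_lambda _ fun i => hz i
  have hUV : IndepFun U (z t) μ := by
    have h := hind.indepFun_finset (Finset.range t) {t} (by simp) hz
    exact h.comp (φ := id) (ψ := fun v : ({t} : Finset ℕ) → Z => v ⟨t, by simp⟩) measurable_id
      (measurable_pi_apply _)
  have hmap := hUV.map_prod_eq_prod_map_map hU.aemeasurable (hz t).aemeasurable
  have hΦe : ∀ ω a, Φ (fun i => z i ω, a) = Φ (e (U ω), a) := fun ω a =>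
    hpast _ _ (fun s hs => by simp [e, U, hs]) a
  have hΨ : Measurable fun p : (Finset.range t → Z) × Z => Φ (e p.1, p.2) :=
    hΦ.comp ((he.comp measurable_fst).prodMk measurable_snd)
  have : IsProbabilityMeasure (μ.map U) := Measure.isProbabilityMeasure_map hU.aemeasurable
  simp_rw [hΦe]
  rw [← lintegral_map hΨ (hU.prodMk (hz t)), hmap, lintegral_prod _ hΨ.aemeasurable, hρ,
    lintegral_map hΨ.lintegral_prod_right' hU]

/-! ### Growth, measurability and exponential moments of the iterates -/

section Iterates

variable {X Y : Type*} {H : Type*} [NormedAddCommGroup H] [InnerProductSpace ℝ H]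
  [CompleteSpace H] [RKHS ℝ H X ℝ] {K : X → X → ℝ} {φ : Y → ℝ → ℝ} {α L : ℝ} {η : ℕ → ℝ}

theorem ogd_congr {w w' : ℕ → X × Y} {t : ℕ} (h : ∀ s < t, w s = w' s) :
    ogd H φ η w t = ogd H φ η w' t := by
  induction t with
  | zero => rfl
  | succ t ih =>
    rw [ogd, ogd, ih fun s hs => h s (hs.trans t.lt_succ_self), h t t.lt_succ_self]

/-- Comparing each step with 0, where the loss is at most B, the squared norm grows by O(η_t) at
most, on every path. -/
theorem IsHolderLoss.norm_sq_ogd_le (hφ : IsHolderLoss φ α L) (hH : HasKernel H K)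
    (hκ : BddAbove (Set.range fun x : X => √(K x x))) {A c B : ℝ} (hA : 0 ≤ A) (hc : 0 ≤ c)
    (hd : ∀ y s, deriv (φ y) s ^ 2 ≤ A * φ y s + c) (hη : ∀ t, 0 < η t)
    (hη_le : ∀ t, η t * (A * kernelBound K ^ 2) ≤ 1) (hη_anti : Antitone η)
    (hB0 : 0 ≤ B) (hB : ∀ y, φ y 0 ≤ B) (w : ℕ → X × Y) (t : ℕ) :
    ‖ogd H φ η w t‖ ^ 2 ≤ (2 * B + η 0 * (kernelBound K ^ 2 * (A * B + c))) *
      ∑ s ∈ Finset.range t, η s := by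
  induction t with
  | zero => simp [ogd]
  | succ t ih =>
    have h := hφ.norm_sq_step_sub_le hH hκ hA hd (hη t).le (ogd H φ η w t) 0 (w t).1 (w t).2
      (by simpa using hB (w t).2)
    rw [sub_zero, sub_zero] at h
    rw [Finset.sum_range_succ, mul_add]
    refine h.trans ?_
    set E := kernelBound K ^ 2 * (A * B + c)
    have hE : 0 ≤ E := by positivity
    set b := 2 * η t - η t ^ 2 * (A * kernelBound K ^ 2)
    have hb0 : 0 ≤ b := by nlinarith [hη t, hη_le t]
    have hb2 : b ≤ 2 * η t := by
      have : 0 ≤ η t ^ 2 * (A * kernelBound K ^ 2) := by positivity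
      linarith
    have h1 : b * (-B) ≤
        b * (φ (w t).2 (ogd H φ η w t (w t).1) - φ (w t).2 ((0 : H) (w t).1)) := by
      refine mul_le_mul_of_nonneg_left ?_ hb0
      have := hφ.nonneg (w t).2 (ogd H φ η w t (w t).1)
      have := hB (w t).2
      simp only [RKHS.coe_zero, Pi.zero_apply]
      linarith
    have h2 : b * B ≤ 2 * η t * B := by gcongr
    have h3 : η t ^ 2 * E ≤ η 0 * E * η t := by
      have := hη_anti (Nat.zero_le t)
      have h0 := (hη t).le
      calc η t ^ 2 * E = η t * E * η t := by ring
        _ ≤ _ := by gcongr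
    linarith

/-- For decreasing and square summable step sizes, `η_t ‖f_t‖²` stays bounded. -/
theorem IsHolderLoss.exists_mul_norm_sq_ogd_sub_le (hφ : IsHolderLoss φ α L) (hH : HasKernel H K)
    (hκ : BddAbove (Set.range fun x : X => √(K x x))) {A c : ℝ} (hA : 0 ≤ A) (hc : 0 ≤ c)
    (hd : ∀ y s, deriv (φ y) s ^ 2 ≤ A * φ y s + c) (hη : ∀ t, 0 < η t)
    (hη_le : ∀ t, η t * (A * kernelBound K ^ 2) ≤ 1) (hη_anti : Antitone η)
    (hη_sq : Summable fun t => η t ^ 2) (hφ0 : BddAbove (Set.range fun y : Y => φ y 0)) (g : H) :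
    ∃ Q : ℝ, 0 ≤ Q ∧ ∀ w t, η t * ‖ogd H φ η w t - g‖ ^ 2 ≤ Q := by
  obtain ⟨B', hB'⟩ := hφ0
  have hB : ∀ y, φ y 0 ≤ max B' 0 := fun y => (hB' ⟨y, rfl⟩).trans (le_max_left _ _)
  have hB0 : 0 ≤ max B' 0 := le_max_right _ _
  set B := max B' 0
  have hη0 := hη 0
  set C := 2 * B + η 0 * (kernelBound K ^ 2 * (A * B + c)) with hC
  have hC0 : 0 ≤ C := by positivity
  have hS0 : 0 ≤ ∑' t, η t ^ 2 := tsum_nonneg fun t => sq_nonneg _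
  refine ⟨2 * (C * ∑' t, η t ^ 2) + 2 * (η 0 * ‖g‖ ^ 2), by positivity, fun w t => ?_⟩
  have h1 := hφ.norm_sq_ogd_le hH hκ hA hc hd hη hη_le hη_anti hB0 hB w t
  -- By monotonicity η_t η_s ≤ η_s² for s < t.
  have h2 : η t * ∑ s ∈ Finset.range t, η s ≤ ∑' t, η t ^ 2 := by
    rw [Finset.mul_sum]
    refine le_trans (Finset.sum_le_sum fun s hs => ?_)
      (hη_sq.sum_le_tsum (Finset.range t) fun s _ => sq_nonneg _)
    rw [sq]
    exact mul_le_mul_of_nonneg_right (hη_anti (Finset.mem_range.1 hs).le) (hη s).le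
  have h3 : ‖ogd H φ η w t - g‖ ^ 2 ≤ 2 * ‖ogd H φ η w t‖ ^ 2 + 2 * ‖g‖ ^ 2 := by
    have := norm_sub_le (ogd H φ η w t) g
    nlinarith [norm_nonneg (ogd H φ η w t - g), sq_nonneg (‖ogd H φ η w t‖ - ‖g‖)]
  have h4 := mul_le_mul_of_nonneg_left (h3.trans (add_le_add_left
    (mul_le_mul_of_nonneg_left h1 zero_le_two) _)) (hη t).le
  have h5 := mul_le_mul_of_nonneg_left h2 hC0
  have h6 : η t * ‖g‖ ^ 2 ≤ η 0 * ‖g‖ ^ 2 := by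
    have := hη_anti (Nat.zero_le t)
    gcongr
  linear_combination h4 + 2 * h5 + 2 * h6

variable [TopologicalSpace X] [MeasurableSpace X] [MeasurableSpace Y]

theorem convexOn_risk [OpensMeasurableSpace X] (hH : HasKernel H K)
    (hK : Continuous fun p : X × X => K p.1 p.2)
    (hκ : BddAbove (Set.range fun x : X => √(K x x)))
    (hm : Measurable fun p : Y × ℝ => φ p.1 p.2)
    (hφ : IsHolderLoss φ α L) (hα : 0 < α) (hα1 : α ≤ 1)
    (hL : 0 < L) (hφ0 : BddAbove (Set.range fun y : Y => φ y 0))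
    (ρ : Measure (X × Y)) [IsFiniteMeasure ρ] :
    ConvexOn ℝ Set.univ fun f : H => risk ρ φ f := by
  refine ⟨convex_univ, fun f _ g _ a b ha hb hab => ?_⟩
  have hif := hH.integrable_loss hK hκ hm hφ hα hα1 hL hφ0 ρ f
  have hig := hH.integrable_loss hK hκ hm hφ hα hα1 hL hφ0 ρ g
  have hi := hH.integrable_loss hK hκ hm hφ hα hα1 hL hφ0 ρ (a • f + b • g)
  simp only [risk, smul_eq_mul]
  rw [← integral_const_mul, ← integral_const_mul,
    ← integral_add (hif.const_mul a) (hig.const_mul b)]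
  refine integral_mono hi ((hif.const_mul a).add (hig.const_mul b)) fun z => ?_
  simpa using (hφ.convex z.2).2 (Set.mem_univ (f z.1)) (Set.mem_univ (g z.1)) ha hb hab

variable [OpensMeasurableSpace X] [SecondCountableTopology X]

/-- Evaluation is the inner product with the section. No separability of H is assumed; second
countability of X makes the continuous section strongly measurable. -/
theorem HasKernel.measurable_apply_apply {S : Type*} [MeasurableSpace S] (hH : HasKernel H K)
    (hK : Continuous fun p : X × X => K p.1 p.2) {F : S → H} (hF : StronglyMeasurable F)
    {x : S → X} (hx : Measurable x) : Measurable fun s => F s (x s) := by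
  have hk : StronglyMeasurable (kernelSection H : X → H) :=
    (hH.continuous_kernelSection hK).stronglyMeasurable
  simpa only [Function.comp_apply, inner_kernelSection] using (hF.inner (𝕜 := ℝ) (hk.comp_measurable hx)).measurable

theorem HasKernel.stronglyMeasurable_step {S : Type*} [MeasurableSpace S] (hH : HasKernel H K)
    (hK : Continuous fun p : X × X => K p.1 p.2) (hm : Measurable fun p : Y × ℝ => φ p.1 p.2)
    (hφ : IsHolderLoss φ α L) {F : S → H} (hF : StronglyMeasurable F)
    {z : S → X × Y} (hz : Measurable z) (r : ℝ) :
    StronglyMeasurable fun s =>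
      F s - (r * deriv (φ (z s).2) (F s (z s).1)) • kernelSection H (z s).1 := by
  have hk : StronglyMeasurable (kernelSection H : X → H) :=
    (hH.continuous_kernelSection hK).stronglyMeasurable
  have hx : Measurable fun s => (z s).1 := measurable_fst.comp hz
  have hd : Measurable fun s => r * deriv (φ (z s).2) (F s (z s).1) :=
    ((hφ.measurable_deriv hm).comp ((measurable_snd.comp hz).prodMk
      (hH.measurable_apply_apply hK hF hx))).const_mul r
  exact hF.sub (hd.stronglyMeasurable.smul (hk.comp_measurable hx))

theorem HasKernel.stronglyMeasurable_ogd (hH : HasKernel H K)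
    (hK : Continuous fun p : X × X => K p.1 p.2) (hm : Measurable fun p : Y × ℝ => φ p.1 p.2)
    (hφ : IsHolderLoss φ α L) (t : ℕ) :
    StronglyMeasurable fun w : ℕ → X × Y => ogd H φ η w t := by
  induction t with
  | zero => exact stronglyMeasurable_const
  | succ t ih => exact hH.stronglyMeasurable_step hK hm hφ ih (measurable_pi_apply t) (η t)

theorem HasKernel.measurable_risk {S : Type*} [MeasurableSpace S] (hH : HasKernel H K)
    (hK : Continuous fun p : X × X => K p.1 p.2) (hm : Measurable fun p : Y × ℝ => φ p.1 p.2)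
    (ρ : Measure (X × Y)) [SFinite ρ] {F : S → H} (hF : StronglyMeasurable F) :
    Measurable fun s => risk ρ φ (F s) := by
  have h : Measurable fun p : S × (X × Y) => φ p.2.2 (F p.1 p.2.1) :=
    hm.comp ((measurable_snd.comp measurable_snd).prodMk
      (hH.measurable_apply_apply hK (hF.comp_measurable measurable_fst)
        (measurable_fst.comp measurable_snd)))
  exact h.stronglyMeasurable.integral_prod_right'.measurable

/-- An exponential moment bound for the accumulated excess risk of online gradient descent. The
coefficient of the squared distance decreases in time, which absorbs the conditional variances. -/
theorem lintegral_exp_sum_risk_le (hH : HasKernel H K)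
    (hK : Continuous fun p : X × X => K p.1 p.2)
    (hκ : BddAbove (Set.range fun x : X => √(K x x)))
    (hm : Measurable fun p : Y × ℝ => φ p.1 p.2)
    (hφ : IsHolderLoss φ α L) (hα : 0 < α) (hα1 : α ≤ 1)
    (hL : 0 < L) (hφ0 : BddAbove (Set.range fun y : Y => φ y 0))
    (ρ : Measure (X × Y)) [IsProbabilityMeasure ρ] {A c B Q E l : ℝ} (hA : 0 ≤ A) (hc : 0 ≤ c)
    (hd : ∀ y s, deriv (φ y) s ^ 2 ≤ A * φ y s + c) (hη : ∀ t, 0 < η t)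
    (hη_le : ∀ t, η t * (A * kernelBound K ^ 2) ≤ 1)
    (hη_sq : Summable fun t => η t ^ 2) (g : H)
    (hg : ∀ f : H, risk ρ φ g ≤ risk ρ φ f)
    (hQ : ∀ (w : ℕ → X × Y) t, η t * ‖ogd H φ η w t - g‖ ^ 2 ≤ Q)
    (hB : ∀ y x, φ y (g x) ≤ B) (hE : E = kernelBound K ^ 2 * (A * B + c))
    (hl : 0 ≤ l) (hlB : ∀ t, 2 * l * η t * B ≤ 1)
    (hlQ : 16 * l * (Q * (A * kernelBound K ^ 2)) ≤ 1)
    (hlE : 16 * l * (E * ∑' t, η t ^ 2) ≤ 1)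
    {Ω : Type*} [MeasurableSpace Ω] {μ : Measure Ω} [IsProbabilityMeasure μ]
    {z : ℕ → Ω → X × Y} (hz : ∀ t, Measurable (z t)) (hind : iIndepFun z μ)
    (hρ : ∀ t, μ.map (z t) = ρ) (t : ℕ) :
    ∫⁻ ω, ENNReal.ofReal (Real.exp
      ((l - 8 * (l ^ 2 * E * ∑ s ∈ Finset.range t, η s ^ 2)) *
          ‖ogd H φ η (fun i => z i ω) t - g‖ ^ 2 +
        l / 4 * ∑ s ∈ Finset.range t,
          η s * (risk ρ φ (ogd H φ η (fun i => z i ω) s) - risk ρ φ g))) ∂μ ≤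
      ENNReal.ofReal (Real.exp (l * ‖g‖ ^ 2 + l * E * ∑ s ∈ Finset.range t, η s ^ 2)) := by
  have hB0 : 0 ≤ B := by
    obtain ⟨z⟩ : Nonempty (X × Y) := ρ.nonempty_of_neZero
    exact (hφ.nonneg _ _).trans (hB z.2 z.1)
  have hE0 : 0 ≤ E := by rw [hE]; positivity
  induction t with
  | zero => simp [ogd]
  | succ t ih =>
    set l' := l - 8 * (l ^ 2 * E * ∑ s ∈ Finset.range (t + 1), η s ^ 2) with hl'_def
    have hsum0 : 0 ≤ ∑ s ∈ Finset.range (t + 1), η s ^ 2 := Finset.sum_nonneg fun s _ => sq_nonneg _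
    have hl' : l' ≤ l := by
      have : 0 ≤ l ^ 2 * E * ∑ s ∈ Finset.range (t + 1), η s ^ 2 := by positivity
      linarith
    have hl2 : l / 2 ≤ l' := by
      have h1 : ∑ s ∈ Finset.range (t + 1), η s ^ 2 ≤ ∑' t, η t ^ 2 :=
        hη_sq.sum_le_tsum _ fun s _ => sq_nonneg _
      have h2 : l ^ 2 * E * ∑ s ∈ Finset.range (t + 1), η s ^ 2 ≤
          l ^ 2 * E * ∑' t, η t ^ 2 := by gcongr
      have h3 := mul_le_mul_of_nonneg_left hlE hl
      linear_combination 8 * h2 + h3 / 2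
    -- The drop of the coefficient at this step is exactly what the conditional variance costs.
    have hl_succ : l' + 8 * (l ^ 2 * E * η t ^ 2) =
        l - 8 * (l ^ 2 * E * ∑ s ∈ Finset.range t, η s ^ 2) := by
      rw [hl'_def, Finset.sum_range_succ]
      ring
    -- The sum includes index t, yet it depends only on the examples before t, as iterate t does.
    let R : (ℕ → X × Y) → ℝ := fun w => l / 4 * ∑ s ∈ Finset.range (t + 1),
          η s * (risk ρ φ (ogd H φ η w s) - risk ρ φ g)
    let Φ : (ℕ → X × Y) × (X × Y) → ENNReal := fun p =>
      ENNReal.ofReal (Real.exp (R p.1)) * ENNReal.ofReal (Real.exp (l' *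
        ‖ogd H φ η p.1 t - (η t * deriv (φ p.2.2) (ogd H φ η p.1 t p.2.1)) •
          kernelSection H p.2.1 - g‖ ^ 2))
    have hRm : Measurable R := by
      refine (Finset.measurable_sum _ fun s _ => ?_).const_mul _
      exact ((hH.measurable_risk hK hm ρ
        (hH.stronglyMeasurable_ogd hK hm hφ s)).sub_const _).const_mul _
    have hΦm : Measurable Φ := by
      refine (hRm.comp measurable_fst).exp.ennreal_ofReal.mul ?_
      have h := (hH.stronglyMeasurable_step hK hm hφ
        ((hH.stronglyMeasurable_ogd hK hm hφ (η := η) t).comp_measurable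
          (measurable_fst (β := X × Y)))
        measurable_snd (η t)).sub (stronglyMeasurable_const (b := g))
      exact ((h.norm.measurable.pow_const 2).const_mul l').exp.ennreal_ofReal
    have hpast : ∀ w w' : ℕ → X × Y, (∀ s < t, w s = w' s) → ∀ a, Φ (w, a) = Φ (w', a) := by
      intro w w' hw a
      have h1 : ∀ s ≤ t, ogd H φ η w s = ogd H φ η w' s := fun s hs =>
        ogd_congr fun r hr => hw r (hr.trans_le hs)
      have h2 : R w = R w' := by
        refine congrArg (l / 4 * ·) (Finset.sum_congr rfl fun s hs => ?_)
        rw [h1 s (Finset.mem_range_succ_iff.1 hs)]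
      simp only [Φ, h2, h1 t le_rfl]
    have hinner : ∀ w : ℕ → X × Y, ∫⁻ a, Φ (w, a) ∂ρ ≤
        ENNReal.ofReal (Real.exp (l * E * η t ^ 2)) * ENNReal.ofReal (Real.exp
          ((l - 8 * (l ^ 2 * E * ∑ s ∈ Finset.range t, η s ^ 2)) *
            ‖ogd H φ η w t - g‖ ^ 2 +
          l / 4 * ∑ s ∈ Finset.range t, η s * (risk ρ φ (ogd H φ η w s) - risk ρ φ g))) := by
      intro w
      have h := lintegral_exp_norm_sq_step_le hH hK hκ hm hφ hα hα1 hL hφ0 ρ hA hc hd (hη t)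
        (hη_le t) (ogd H φ η w t) g (hg _) (hQ w t) hB hl hl' hl2 (hlB t) hlQ
      rw [← hE, hl_succ] at h
      simp only [Φ]
      rw [lintegral_const_mul' _ _ ENNReal.ofReal_ne_top]
      refine (mul_le_mul_right h _).trans (le_of_eq ?_)
      rw [← ENNReal.ofReal_mul (Real.exp_pos _).le, ← Real.exp_add,
        ← ENNReal.ofReal_mul (Real.exp_pos _).le, ← Real.exp_add]
      congr 2
      simp only [R, Finset.sum_range_succ]
      ring
    calc _ = ∫⁻ ω, Φ (fun i => z i ω, z t ω) ∂μ := by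
          refine lintegral_congr fun ω => ?_
          simp only [Φ]
          rw [← ENNReal.ofReal_mul (Real.exp_pos _).le, ← Real.exp_add, add_comm]
          rfl
      _ = ∫⁻ ω, ∫⁻ a, Φ (fun i => z i ω, a) ∂ρ ∂μ :=
          lintegral_past_next hz hind (hρ t) hΦm hpast
      _ ≤ _ := lintegral_mono fun ω => hinner _
      _ = _ := lintegral_const_mul' _ _ ENNReal.ofReal_ne_top
      _ ≤ _ := mul_le_mul_right ih _
      _ = _ := by
          rw [← ENNReal.ofReal_mul (Real.exp_pos _).le, ← Real.exp_add, Finset.sum_range_succ]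
          congr 2
          ring

end Iterates

/-! ### From exponential moments to high probability -/

section Conclusion

variable {X Y : Type*} {H : Type*} [NormedAddCommGroup H] [InnerProductSpace ℝ H]
  [CompleteSpace H] [RKHS ℝ H X ℝ] {K : X → X → ℝ} {φ : Y → ℝ → ℝ} {α L : ℝ} {η : ℕ → ℝ}

/-- Markov's inequality for the exponential of a random variable. -/
theorem one_sub_le_measureReal_of_lintegral_exp_le {Ω : Type*} [MeasurableSpace Ω] {μ : Measure Ω}
    [IsProbabilityMeasure μ] {S : Ω → ℝ} (hS : Measurable S) {m δ : ℝ} (hδ : 0 < δ)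
    (h : ∫⁻ ω, ENNReal.ofReal (Real.exp (S ω)) ∂μ ≤ ENNReal.ofReal (Real.exp m)) :
    1 - δ ≤ μ.real {ω | S ω ≤ m + Real.log (1 / δ)} := by
  have hms : MeasurableSet {ω | S ω ≤ m + Real.log (1 / δ)} := measurableSet_le hS measurable_const
  have hbad : μ {ω | S ω ≤ m + Real.log (1 / δ)}ᶜ ≤ ENNReal.ofReal δ := by
    have hpos : 0 < Real.exp m / δ := by positivity
    have hsub : {ω | S ω ≤ m + Real.log (1 / δ)}ᶜ ⊆
        {ω | ENNReal.ofReal (Real.exp m / δ) ≤ ENNReal.ofReal (Real.exp (S ω))} := by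
      intro ω hω
      refine ENNReal.ofReal_le_ofReal ?_
      have h1 : m + Real.log (1 / δ) < S ω := not_le.1 hω
      have h2 := Real.exp_le_exp.2 h1.le
      rwa [Real.exp_add, Real.exp_log (by positivity), mul_one_div] at h2
    calc μ {ω | S ω ≤ m + Real.log (1 / δ)}ᶜ
        ≤ (∫⁻ ω, ENNReal.ofReal (Real.exp (S ω)) ∂μ) / ENNReal.ofReal (Real.exp m / δ) :=
          (measure_mono hsub).trans (meas_ge_le_lintegral_div hS.exp.ennreal_ofReal.aemeasurable
            (by simpa using hpos) ENNReal.ofReal_ne_top)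
      _ ≤ ENNReal.ofReal (Real.exp m) / ENNReal.ofReal (Real.exp m / δ) := by gcongr
      _ = ENNReal.ofReal δ := by
          rw [← ENNReal.ofReal_div_of_pos hpos]
          congr 1
          field_simp
  have h1 : μ.real {ω | S ω ≤ m + Real.log (1 / δ)}ᶜ ≤ δ :=
    ENNReal.toReal_le_of_le_ofReal hδ.le hbad
  rw [probReal_compl_eq_one_sub hms] at h1
  linarith

variable [TopologicalSpace X] [MeasurableSpace X] [MeasurableSpace Y] [OpensMeasurableSpace X]

/-- Jensen's inequality for the convex risk. -/
theorem risk_weightedAverage_sub_le (hH : HasKernel H K)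
    (hK : Continuous fun p : X × X => K p.1 p.2)
    (hκ : BddAbove (Set.range fun x : X => √(K x x)))
    (hm : Measurable fun p : Y × ℝ => φ p.1 p.2)
    (hφ : IsHolderLoss φ α L) (hα : 0 < α) (hα1 : α ≤ 1)
    (hL : 0 < L) (hφ0 : BddAbove (Set.range fun y : Y => φ y 0))
    (ρ : Measure (X × Y)) [IsFiniteMeasure ρ] (hη : ∀ t, 0 < η t) (f : ℕ → H) (r : ℝ) {T : ℕ}
    (hT : 1 ≤ T) :
    risk ρ φ (weightedAverage (H := H) η f T) - r ≤
      (∑ t ∈ Finset.range T, η t * (risk ρ φ (f t) - r)) / ∑ t ∈ Finset.range T, η t := by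
  have hpos : 0 < ∑ t ∈ Finset.range T, η t :=
    Finset.sum_pos (fun t _ => hη t) ⟨0, Finset.mem_range.2 hT⟩
  have h := (convexOn_risk hH hK hκ hm hφ hα hα1 hL hφ0 ρ).map_centerMass_le
    (t := Finset.range T) (w := η) (p := f) (fun t _ => (hη t).le) hpos (fun t _ => Set.mem_univ _)
  have h1 : weightedAverage η f T = (Finset.range T).centerMass η f := rfl
  rw [h1, le_div_iff₀ hpos]
  simp_rw [mul_sub]
  rw [Finset.sum_sub_distrib, ← Finset.sum_mul, sub_mul, mul_comm r]
  refine sub_le_sub_right ?_ _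
  rw [← le_div_iff₀ hpos]
  refine h.trans (le_of_eq ?_)
  simp [Finset.centerMass, div_eq_inv_mul]

variable [SecondCountableTopology X]

theorem exists_one_sub_le_measureReal_sum_risk_le (hH : HasKernel H K)
    (hK : Continuous fun p : X × X => K p.1 p.2)
    (hκ : BddAbove (Set.range fun x : X => √(K x x)))
    (hm : Measurable fun p : Y × ℝ => φ p.1 p.2)
    (hφ : IsHolderLoss φ α L) (hα : 0 < α) (hα1 : α ≤ 1)
    (hL : 0 < L) (hφ0 : BddAbove (Set.range fun y : Y => φ y 0))
    (ρ : Measure (X × Y)) [IsProbabilityMeasure ρ] (hη : ∀ t, 0 < η t)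
    (hη_le : ∀ t, η t * (stepConst α L * kernelBound K ^ 2) ≤ 1) (hη_anti : Antitone η)
    (hη_sq : Summable fun t => η t ^ 2) (g : H)
    (hg : ∀ f : H, risk ρ φ g ≤ risk ρ φ f)
    (hgB : BddAbove (Set.range fun z : X × Y => φ z.2 (g z.1))) :
    ∃ a m : ℝ, 0 < a ∧ 0 ≤ m ∧ ∀ (Ω : Type*) [MeasurableSpace Ω] (μ : Measure Ω)
      [IsProbabilityMeasure μ] (z : ℕ → Ω → X × Y), (∀ t, Measurable (z t)) → iIndepFun z μ →
      (∀ t, μ.map (z t) = ρ) → ∀ (T : ℕ) (δ : ℝ), 0 < δ →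
        1 - δ ≤ μ.real {ω | ∑ t ∈ Finset.range T, η t *
          (risk ρ φ (ogd H φ η (fun i => z i ω) t) - risk ρ φ g) ≤
            a * (m + Real.log (1 / δ))} := by
  obtain ⟨c, hc, hd⟩ := hφ.exists_sq_deriv_le hα hα1 hL
  have hA := (stepConst_pos hα hL).le
  set A := stepConst α L
  obtain ⟨Q, hQ0, hQ⟩ :=
    hφ.exists_mul_norm_sq_ogd_sub_le hH hκ hA hc hd hη hη_le hη_anti hη_sq hφ0 g
  obtain ⟨B, hB'⟩ := hgB
  have hB : ∀ y x, φ y (g x) ≤ B := fun y x => hB' ⟨(x, y), rfl⟩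
  have hB0 : 0 ≤ B := by
    obtain ⟨z⟩ : Nonempty (X × Y) := ρ.nonempty_of_neZero
    exact (hφ.nonneg _ _).trans (hB z.2 z.1)
  obtain ⟨E, hE⟩ : ∃ E, E = kernelBound K ^ 2 * (A * B + c) := ⟨_, rfl⟩
  have hE0 : 0 ≤ E := by rw [hE]; positivity
  set V := ∑' t, η t ^ 2
  have hV0 : 0 ≤ V := tsum_nonneg fun t => sq_nonneg _
  have hη0 := hη 0
  -- With l = 1/N, each summand secures one smallness condition on l, and the 1 keeps N positive.
  set N := 1 + 2 * η 0 * B + 16 * (Q * (A * kernelBound K ^ 2)) + 16 * (E * V) with hN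
  have t1 : 0 ≤ 2 * η 0 * B := by positivity
  have t2 : 0 ≤ 16 * (Q * (A * kernelBound K ^ 2)) := by positivity
  have t3 : 0 ≤ 16 * (E * V) := by positivity
  have hNpos : 0 < N := by linarith
  have hle : ∀ x, x ≤ N → N⁻¹ * x ≤ 1 := fun x hx => by
    rw [inv_mul_le_iff₀ hNpos]
    linarith
  set l := N⁻¹ with hl_def
  have hl : 0 < l := inv_pos.2 hNpos
  have hlB : ∀ t, 2 * l * η t * B ≤ 1 := fun t => by
    have h1 : 2 * η t * B ≤ 2 * η 0 * B := by
      have := hη_anti (Nat.zero_le t)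
      gcongr
    have := hle (2 * η t * B) (by linarith)
    linarith
  have hlQ : 16 * l * (Q * (A * kernelBound K ^ 2)) ≤ 1 := by
    have := hle (16 * (Q * (A * kernelBound K ^ 2))) (by linarith)
    linarith
  have hlE : 16 * l * (E * V) ≤ 1 := by
    have := hle (16 * (E * V)) (by linarith)
    linarith
  refine ⟨4 / l, l * ‖g‖ ^ 2 + l * E * V, by positivity, by positivity, ?_⟩
  intro Ω _ μ _ z hz hind hρ T δ hδ
  set S : Ω → ℝ := fun ω => ∑ t ∈ Finset.range T, η t *
    (risk ρ φ (ogd H φ η (fun i => z i ω) t) - risk ρ φ g)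
  have hSm : Measurable S := by
    refine Finset.measurable_sum _ fun t _ => ?_
    refine ((hH.measurable_risk hK hm ρ ?_).sub_const _).const_mul _
    exact (hH.stronglyMeasurable_ogd hK hm hφ t).comp_measurable
      (measurable_pi_lambda _ fun i => hz i)
  have hsum : ∑ s ∈ Finset.range T, η s ^ 2 ≤ V := hη_sq.sum_le_tsum _ fun s _ => sq_nonneg _
  have hexp := lintegral_exp_sum_risk_le hH hK hκ hm hφ hα hα1 hL hφ0 ρ hA hc hd hη hη_le hη_sq
    g hg hQ hB hE hl.le hlB hlQ hlE hz hind hρ T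
  -- The distance term in the exponent is nonnegative and can be dropped.
  have hcoef : 0 ≤ l - 8 * (l ^ 2 * E * ∑ s ∈ Finset.range T, η s ^ 2) := by
    have h1 : l ^ 2 * E * ∑ s ∈ Finset.range T, η s ^ 2 ≤ l ^ 2 * E * V := by gcongr
    have h2 := mul_le_mul_of_nonneg_left hlE hl.le
    linear_combination 8 * h1 + h2 / 2 + hl / 2
  have hexp' : ∫⁻ ω, ENNReal.ofReal (Real.exp (l / 4 * S ω)) ∂μ ≤
      ENNReal.ofReal (Real.exp (l * ‖g‖ ^ 2 + l * E * V)) := by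
    refine (lintegral_mono fun ω => ?_).trans (hexp.trans ?_)
    · refine ENNReal.ofReal_le_ofReal (Real.exp_le_exp.2 ?_)
      exact le_add_of_nonneg_left (mul_nonneg hcoef (sq_nonneg _))
    · refine ENNReal.ofReal_le_ofReal (Real.exp_le_exp.2 ?_)
      gcongr
  refine (one_sub_le_measureReal_of_lintegral_exp_le (hSm.const_mul (l / 4)) hδ hexp').trans ?_
  refine measureReal_mono fun ω hω => ?_
  have h1 : l / 4 * S ω ≤ l * ‖g‖ ^ 2 + l * E * V + Real.log (1 / δ) := hω
  change S ω ≤ _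
  have h2 := mul_le_mul_of_nonneg_left h1 (by positivity : 0 ≤ 4 / l)
  have h3 : 4 / l * (l / 4 * S ω) = S ω := by field_simp
  linarith

/-- The logarithm ℓ on the right is at least log 2 > 1/2, so √ℓ ≥ 1/2; hence 1 ≤ 4ℓ^(3/2) and
log(1/δ) ≤ ℓ ≤ 2ℓ^(3/2). -/
theorem add_log_one_div_le_mul_rpow {m δ : ℝ} {T : ℕ} (hm : 0 ≤ m) (hT : 1 ≤ T) (hδ : 0 < δ)
    (hδ1 : δ < 1) :
    m + Real.log (1 / δ) ≤ (4 * m + 2) * Real.log (2 * T / δ) ^ (3 / 2 : ℝ) := by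
  have hT' : (1 : ℝ) ≤ T := by exact_mod_cast hT
  have h1 : Real.log 2 ≤ Real.log (2 * T / δ) := by
    refine Real.log_le_log two_pos ?_
    rw [le_div_iff₀ hδ]
    nlinarith
  have h2 : Real.log (1 / δ) ≤ Real.log (2 * T / δ) := by
    refine Real.log_le_log (by positivity) ?_
    gcongr
    linarith
  set ℓ := Real.log (2 * T / δ)
  have h3 : 1 / 2 ≤ ℓ := by linarith [Real.log_two_gt_d9]
  have h4 : 1 / 2 ≤ √ℓ := Real.le_sqrt_of_sq_le (by linarith)
  have h5 : ℓ ^ (3 / 2 : ℝ) = ℓ * √ℓ := by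
    rw [Real.sqrt_eq_rpow, ← Real.rpow_one_add' (by linarith) (by norm_num)]
    norm_num
  have h6 : 1 ≤ 2 * √ℓ := by linarith
  have h7 : ℓ ≤ 2 * (ℓ * √ℓ) := by nlinarith
  rw [h5]
  nlinarith

end Conclusion

end OnlineLearning

theorem theorem5 {d : ℕ} (X : Set (EuclideanSpace ℝ (Fin d))) (Y : Set ℝ)
    -- the law of an example
    (ρ : Measure (X × Y)) [IsProbabilityMeasure ρ]
    -- the kernel and its reproducing kernel Hilbert space
    (K : X → X → ℝ) (hK : OnlineLearning.IsMercerKernel K)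
    (H : Type*) [NormedAddCommGroup H] [InnerProductSpace ℝ H] [CompleteSpace H]
    [RKHS ℝ H X ℝ] (hH : OnlineLearning.HasKernel H K)
    (hκ : BddAbove (Set.range fun x : X => √(K x x)))
    -- the loss
    (φ : Y → ℝ → ℝ) (hφ_meas : Measurable fun p : Y × ℝ => φ p.1 p.2)
    (α L : ℝ) (hα : 0 < α) (hα1 : α ≤ 1) (hL : 0 < L)
    (hφ : OnlineLearning.IsHolderLoss φ α L)
    (hφ0 : BddAbove (Set.range fun y : Y => φ y 0))
    -- the minimizer of the generalization error
    (fH : H) (hfH : ∀ f : H, OnlineLearning.risk ρ φ fH ≤ OnlineLearning.risk ρ φ f)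
    (hφH : BddAbove (Set.range fun z : X × Y => φ z.2 (fH z.1)))
    -- the step sizes
    (η : ℕ → ℝ) (hη_pos : ∀ t, 0 < η t)
    (hη_le : ∀ t, η t * (OnlineLearning.stepConst α L * OnlineLearning.kernelBound K ^ 2) ≤ 1)
    (hη_anti : ∀ t, η (t + 1) ≤ η t) (hη_sq : Summable fun t => η t ^ 2) :
    ∃ C : ℝ, ∀ (Ω : Type*) [MeasurableSpace Ω] (μ : Measure Ω) [IsProbabilityMeasure μ]
      (z : ℕ → Ω → X × Y), (∀ t, Measurable (z t)) → iIndepFun z μ → (∀ t, μ.map (z t) = ρ) →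
      ∀ T : ℕ, 1 ≤ T → ∀ δ : ℝ, 0 < δ → δ < 1 →
        1 - δ ≤ μ.real {ω |
          ∑ t ∈ Finset.range T, η t *
              (OnlineLearning.risk ρ φ (OnlineLearning.ogd H φ η (fun i => z i ω) t)
                - OnlineLearning.risk ρ φ fH)
            ≤ C * Real.log (2 * T / δ) ^ (3 / 2 : ℝ) ∧
          OnlineLearning.risk ρ φ (OnlineLearning.weightedAverage (H := H) η
              (OnlineLearning.ogd H φ η (fun i => z i ω)) T)
              - OnlineLearning.risk ρ φ fH
            ≤ C * Real.log (2 * T / δ) ^ (3 / 2 : ℝ) / ∑ t ∈ Finset.range T, η t} := by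
  have hη_anti' : Antitone η := antitone_nat_of_succ_le hη_anti
  obtain ⟨a, m, ha, hm0, h⟩ := OnlineLearning.exists_one_sub_le_measureReal_sum_risk_le hH
    hK.continuous hκ hφ_meas hφ hα hα1 hL hφ0 ρ hη_pos hη_le hη_anti' hη_sq fH hfH hφH
  refine ⟨a * (4 * m + 2), fun Ω _ μ _ z hz hind hρ T hT δ hδ hδ1 => ?_⟩
  refine (h Ω μ z hz hind hρ T δ hδ).trans (measureReal_mono fun ω hω => ?_)
  have hlog := mul_le_mul_of_nonneg_left
    (OnlineLearning.add_log_one_div_le_mul_rpow hm0 hT hδ hδ1) ha.le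
  rw [← mul_assoc] at hlog
  have hsum := (show _ ≤ _ from hω).trans hlog
  -- The second bound follows from the first on the same event, so no further probability is lost.
  refine ⟨hsum, ?_⟩
  refine (OnlineLearning.risk_weightedAverage_sub_le hH hK.continuous hκ hφ_meas hφ hα hα1 hL hφ0 ρ
    hη_pos _ _ hT).trans ?_
  exact div_le_div_of_nonneg_right hsum (Finset.sum_nonneg fun t _ => (hη_pos t).le)
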